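/- For a metric space $(Y,d)$ with basepoint $y_0\in Y$, let $\mathrm{Lip}_0(Y)$ be the space of Lipschitz functions $f:Y\to\mathbb{R}$ with $f(y_0)=0$, normed by $\|f\|=\sup_{p\neq q}\frac{|f(p)-f(q)|}{d(p,q)}$. The Lipschitz free space $\mathcal{F}(Y)$ is the norm-closed linear span of the evaluations $\delta_p(f)=f(p)$, $p\in Y$, in the dual $\mathrm{Lip}_0(Y)^*$; up to linear isometry it does not depend on the basepoint, and $\mathcal{F}(\emptyset):=\{0\}$. A Banach space has the Schur property if every weakly null sequence in it is norm null. Let $X$ be a complete metric space, and let $\mathcal{I}$ be an ideal of closed subsets of $X$, i.e. a collection of closed subsets of $X$ such that $\emptyset\in\mathcal{I}$; if $B\in\mathcal{I}$ and $A\subseteq B$ is closed in $X$, then $A\in\mathcal{I}$; and if $A,B\in\mathcal{I}$, then $A\cup B\in\mathcal{I}$. Suppose that $X$ is locally-$\mathcal{I}$: for every $p\in X$ there is $\theta>0$ such that the closed ball $\{x\in X: d(x,p)\le\theta\}$ belongs to $\mathcal{I}$. \textbf{Theorem.} If $\mathcal{F}(A)$ has the Schur property for every $A\in\mathcal{I}$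 (with the metric restricted from $X$), then $\mathcal{F}(X)$ has the Schur property. -/

import Mathlib

open Filter Topology

noncomputable section

/-- The real Lipschitz functions on `X` vanishing at the basepoint `x₀`, as a vector space of
functions. -/
def lipZeroSubmodule (X : Type*) [MetricSpace X] (x₀ : X) : Submodule ℝ (X → ℝ) where
  carrier := {f | (∃ K, LipschitzWith K f) ∧ f x₀ = 0}
  zero_mem' := ⟨⟨0, LipschitzWith.const 0⟩, rfl⟩
  add_mem' := by
    rintro f g ⟨⟨K, hK⟩, hf⟩ ⟨⟨L, hL⟩, hg⟩
    exact ⟨⟨K + L, hK.add hL⟩, by simp [hf, hg]⟩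
  smul_mem' := by
    rintro c f ⟨⟨K, hK⟩, hf⟩
    refine ⟨⟨‖c‖₊ * K, ?_⟩, by simp [hf]⟩
    exact (lipschitzWith_smul c).comp hK

/-- The space `Lip₀(X)`. It is a type of its own so that it carries the Lipschitz norm and not the
topology of pointwise convergence. -/
def LipZero (X : Type*) [MetricSpace X] (x₀ : X) : Type _ := ↥(lipZeroSubmodule X x₀)

namespace LipZero

instance (X : Type*) [MetricSpace X] (x₀ : X) : AddCommGroup (LipZero X x₀) :=
  inferInstanceAs (AddCommGroup ↥(lipZeroSubmodule X x₀))

instance (X : Type*) [MetricSpace X] (x₀ : X) : Module ℝ (LipZero X x₀) :=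
  inferInstanceAs (Module ℝ ↥(lipZeroSubmodule X x₀))

instance (X : Type*) [MetricSpace X] (x₀ : X) : CoeFun (LipZero X x₀) (fun _ => X → ℝ) :=
  ⟨fun f => f.1⟩

/-- The norm `‖f‖ = sup_{p ≠ q} |f(p) - f(q)| / d(p, q)`; the supremum is finite by
`LipZero.bddAbove`, and it is `0` on a one-point space. -/
instance (X : Type*) [MetricSpace X] (x₀ : X) : Norm (LipZero X x₀) :=
  ⟨fun f => ⨆ z : {z : X × X // z.1 ≠ z.2}, |f z.1.1 - f z.1.2| / dist z.1.1 z.1.2⟩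

theorem norm_def {X : Type*} [MetricSpace X] {x₀ : X} (f : LipZero X x₀) :
    ‖f‖ = ⨆ z : {z : X × X // z.1 ≠ z.2}, |f z.1.1 - f z.1.2| / dist z.1.1 z.1.2 := rfl

theorem bddAbove {X : Type*} [MetricSpace X] {x₀ : X} (f : LipZero X x₀) :
    BddAbove (Set.range fun z : {z : X × X // z.1 ≠ z.2} =>
      |f z.1.1 - f z.1.2| / dist z.1.1 z.1.2) := by
  obtain ⟨K, hK⟩ := f.2.1
  refine ⟨K, ?_⟩
  rintro _ ⟨z, rfl⟩
  have h := hK.dist_le_mul z.1.1 z.1.2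
  rw [Real.dist_eq] at h
  exact div_le_of_le_mul₀ dist_nonneg K.2 h

theorem norm_nonneg' {X : Type*} [MetricSpace X] {x₀ : X} (f : LipZero X x₀) : 0 ≤ ‖f‖ :=
  Real.iSup_nonneg fun _ => by positivity

theorem abs_sub_le {X : Type*} [MetricSpace X] {x₀ : X} (f : LipZero X x₀) (p q : X) :
    |f p - f q| ≤ ‖f‖ * dist p q := by
  by_cases h : p = q
  · simp [h]
  · have := le_ciSup (bddAbove f) ⟨(p, q), h⟩
    exact (div_le_iff₀ (dist_pos.2 h)).1 this

theorem norm_le {X : Type*} [MetricSpace X] {x₀ : X} (f : LipZero X x₀) {C : ℝ} (hC : 0 ≤ C)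
    (h : ∀ p q, |f p - f q| ≤ C * dist p q) : ‖f‖ ≤ C :=
  Real.iSup_le (fun z => div_le_of_le_mul₀ dist_nonneg hC (h z.1.1 z.1.2)) hC

theorem normCore (X : Type*) [MetricSpace X] (x₀ : X) : NormedSpace.Core ℝ (LipZero X x₀) where
  norm_nonneg := norm_nonneg'
  norm_smul c f := by
    change (⨆ z : {z : X × X // z.1 ≠ z.2},
      |c * f z.1.1 - c * f z.1.2| / dist z.1.1 z.1.2) = ‖c‖ * ‖f‖
    rw [norm_def, Real.mul_iSup_of_nonneg (norm_nonneg c)]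
    simp only [← mul_sub, abs_mul, mul_div_assoc, Real.norm_eq_abs]
  norm_triangle f g := by
    refine norm_le _ (add_nonneg (norm_nonneg' f) (norm_nonneg' g)) fun p q => ?_
    change |(f p + g p) - (f q + g q)| ≤ _
    have hf := abs_sub_le f p q
    have hg := abs_sub_le g p q
    calc |(f p + g p) - (f q + g q)| = |(f p - f q) + (g p - g q)| := by ring_nf
      _ ≤ |f p - f q| + |g p - g q| := abs_add_le _ _
      _ ≤ _ := by rw [add_mul]; exact add_le_add hf hg
  norm_eq_zero_iff f := by
    constructor
    · intro h
      refine Subtype.ext (funext fun p => ?_)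
      have hp := abs_sub_le f p x₀
      rw [h, zero_mul, f.2.2, sub_zero] at hp
      exact abs_nonpos_iff.1 hp
    · rintro rfl
      refine le_antisymm (norm_le _ le_rfl fun p q => ?_) (norm_nonneg' _)
      change |(0 : ℝ) - 0| ≤ _
      simp

instance (X : Type*) [MetricSpace X] (x₀ : X) : NormedAddCommGroup (LipZero X x₀) :=
  NormedAddCommGroup.ofCore (normCore X x₀)

instance (X : Type*) [MetricSpace X] (x₀ : X) : NormedSpace ℝ (LipZero X x₀) :=
  NormedSpace.ofCore (normCore X x₀)

/-- The evaluation functional `δ_p(f) = f(p)` in the dual of `Lip₀(X)`. -/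
def delta {X : Type*} [MetricSpace X] (x₀ : X) (p : X) : StrongDual ℝ (LipZero X x₀) :=
  LinearMap.mkContinuous
    { toFun := fun f => f p
      map_add' := fun _ _ => rfl
      map_smul' := fun _ _ => rfl } (dist p x₀) (fun f => by
        have h := abs_sub_le f p x₀
        rw [f.2.2, sub_zero, mul_comm] at h
        exact h)

@[simp]
theorem delta_apply {X : Type*} [MetricSpace X] (x₀ : X) (p : X) (f : LipZero X x₀) :
    delta x₀ p f = f p := rfl

end LipZero

/-- The Lipschitz free space over `X` with basepoint `x₀`: the norm closure of the linear span of
the evaluations `δ_p`, `p ∈ X`, in the dual of `Lip₀(X)`. -/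
def LipFree (X : Type*) [MetricSpace X] (x₀ : X) : Submodule ℝ (StrongDual ℝ (LipZero X x₀)) :=
  (Submodule.span ℝ (Set.range (LipZero.delta x₀))).topologicalClosure

/-- The Schur property: every weakly null sequence is norm null. -/
def SchurProperty (V : Type*) [NormedAddCommGroup V] [NormedSpace ℝ V] : Prop :=
  ∀ v : ℕ → V, (∀ φ : StrongDual ℝ V, Tendsto (fun n => φ (v n)) atTop (𝓝 0)) →
    Tendsto v atTop (𝓝 0)

/-- A closed set `E` is locally modeled on a collection `I` of closed sets if every point `p` of `E`
has a closed ball `B` around it, of positive radius, with `E ∩ B` in `I`. -/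
def LocallyModeledOn {X : Type*} [MetricSpace X] (I : Set (TopologicalSpace.Closeds X))
    (E : TopologicalSpace.Closeds X) : Prop :=
  ∀ p ∈ E, ∃ θ : ℝ, 0 < θ ∧ E ⊓ ⟨Metric.closedBall p θ, Metric.isClosed_closedBall⟩ ∈ I

end

/-! The core is a compact reduction valid over any complete metric space: up to a uniform norm error
`ε`, a weakly null sequence of the free space may be replaced by a weakly null one supported on a
compact set `K`. The local hypothesis and a finite cover by balls put `K` in the ideal, so the free
space over `K` is Schur. As it sits isometrically in that of `X`, the replacement is norm null, and
`ε` is arbitrary.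

The reduction rests on a gliding hump (`WeaklyNull.gliding_hump`). If mass kept escaping every set
of a suitable family, humps placed successively outside one another would add up to a single
Lipschitz function on which the sequence does not tend to zero. Applied to balls, this gives bounded
supports (`WeaklyNull.exists_bounded`). Applied to neighbourhoods of finite sets, it gives supports
within `2δ` of a finite set (`WeaklyNull.exists_near_finite`). Iterating with `δ → 0` and summable
errors yields a norm limit supported on nested closed sets with ever finer finite nets; by
completeness their intersection is compact, and it carries the limit (`SupportedOn.iInter`). -/

noncomputable section

/-! ### Lipschitz functions: construction and truncation -/

namespace LipZero

variable {X : Type*} [MetricSpace X] {x₀ : X}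

theorem exists_of_abs_sub_le {g : X → ℝ} (h0 : g x₀ = 0) {C : ℝ} (hC : 0 ≤ C)
    (h : ∀ p q, |g p - g q| ≤ C * dist p q) : ∃ f : LipZero X x₀, (∀ p, f p = g p) ∧ ‖f‖ ≤ C := by
  refine ⟨⟨g, ⟨⟨C, hC⟩, LipschitzWith.of_dist_le_mul fun p q => ?_⟩, h0⟩, fun _ => rfl, ?_⟩
  · rw [Real.dist_eq]
    exact h p q
  · exact norm_le _ hC h

@[simp] theorem apply_basepoint (f : LipZero X x₀) : f x₀ = 0 := f.2.2

@[simp] theorem add_apply (f g : LipZero X x₀) (p : X) : (f + g) p = f p + g p := rfl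

@[simp] theorem sub_apply (f g : LipZero X x₀) (p : X) : (f - g) p = f p - g p := rfl

@[simp] theorem smul_apply (c : ℝ) (f : LipZero X x₀) (p : X) : (c • f) p = c * f p := rfl

@[simp] theorem zero_apply (p : X) : (0 : LipZero X x₀) p = 0 := rfl

theorem ext {f g : LipZero X x₀} (h : ∀ p, f p = g p) : f = g := Subtype.ext (funext h)

theorem abs_apply_le (f : LipZero X x₀) (p : X) : |f p| ≤ ‖f‖ * dist p x₀ := by
  simpa using abs_sub_le f p x₀

theorem continuous (f : LipZero X x₀) : Continuous fun p => f p := by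
  obtain ⟨K, hK⟩ := f.2.1
  exact hK.continuous

theorem norm_delta_sub_le (p q : X) : ‖delta x₀ p - delta x₀ q‖ ≤ dist p q := by
  refine ContinuousLinearMap.opNorm_le_bound _ dist_nonneg fun f => ?_
  rw [mul_comm]
  exact abs_sub_le f p q

@[simp] theorem delta_basepoint : delta x₀ x₀ = 0 := by
  ext f
  simp

/-- The truncation of a Lipschitz function to values in `[-ρ, ρ]`. -/
theorem exists_truncation (f : LipZero X x₀) {ρ : ℝ} (hρ : 0 ≤ ρ) :
    ∃ g : LipZero X x₀, ‖g‖ ≤ ‖f‖ ∧ (∀ p, |g p| ≤ ρ) ∧ ∀ p, |f p| ≤ ρ → g p = f p := by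
  obtain ⟨g, hg, hn⟩ := exists_of_abs_sub_le (x₀ := x₀) (g := fun p => max (-ρ) (min ρ (f p)))
    (by simp [hρ]) (norm_nonneg f) (fun p q => by
      refine le_trans ?_ (abs_sub_le f p q)
      refine (abs_max_sub_max_le_max _ _ _ _).trans ?_
      simp only [sub_self, abs_zero]
      refine max_le (abs_nonneg _) ((abs_min_sub_min_le_max _ _ _ _).trans ?_)
      simp)
  refine ⟨g, hn, fun p => ?_, fun p hp => ?_⟩
  · rw [hg, abs_le]
    exact ⟨le_max_left _ _, max_le (by linarith) (min_le_left _ _)⟩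
  · rw [abs_le] at hp
    rw [hg, min_eq_right hp.2, max_eq_right hp.1]

end LipZero

/-! ### The free space: duality and finite approximation -/

namespace LipFree

open LipZero

variable {X : Type*} [MetricSpace X] {x₀ : X}

theorem delta_mem (p : X) : delta x₀ p ∈ LipFree X x₀ :=
  Submodule.le_topologicalClosure _ (Submodule.subset_span ⟨p, rfl⟩)

theorem isClosed : IsClosed (LipFree X x₀ : Set (StrongDual ℝ (LipZero X x₀))) :=
  Submodule.isClosed_topologicalClosure _

theorem le_of_delta_mem {P : Submodule ℝ (StrongDual ℝ (LipZero X x₀))}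
    (hP : IsClosed (P : Set (StrongDual ℝ (LipZero X x₀)))) (h : ∀ p, delta x₀ p ∈ P) :
    LipFree X x₀ ≤ P :=
  Submodule.topologicalClosure_minimal _
    (Submodule.span_le.2 (by rintro _ ⟨p, rfl⟩; exact h p)) hP

theorem comp_mem {Y : Type*} [MetricSpace Y] {y₀ : Y} (A : LipZero Y y₀ →L[ℝ] LipZero X x₀)
    (h : ∀ p, (delta x₀ p).comp A ∈ LipFree Y y₀) {μ : StrongDual ℝ (LipZero X x₀)}
    (hμ : μ ∈ LipFree X x₀) : μ.comp A ∈ LipFree Y y₀ := by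
  let T : StrongDual ℝ (LipZero X x₀) →L[ℝ] StrongDual ℝ (LipZero Y y₀) :=
    ContinuousLinearMap.precomp ℝ A
  have : LipFree X x₀ ≤ (LipFree Y y₀).comap T.toLinearMap :=
    le_of_delta_mem (isClosed.preimage T.continuous) h
  exact this hμ

/-- Bounded functionals on the free space are represented by Lipschitz functions. -/
theorem exists_apply_eq (φ : StrongDual ℝ (StrongDual ℝ (LipZero X x₀))) :
    ∃ f : LipZero X x₀, (∀ p, f p = φ (delta x₀ p)) ∧ ∀ μ ∈ LipFree X x₀, φ μ = μ f := by
  obtain ⟨f, hf, -⟩ := exists_of_abs_sub_le (x₀ := x₀) (g := fun p => φ (delta x₀ p)) (by simp)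
    (norm_nonneg φ) (fun p q => by
      rw [← map_sub]
      exact (φ.le_opNorm _).trans (mul_le_mul_of_nonneg_left (norm_delta_sub_le p q)
        (norm_nonneg _)))
  refine ⟨f, hf, fun μ hμ => ?_⟩
  let ψ : StrongDual ℝ (StrongDual ℝ (LipZero X x₀)) := φ - ContinuousLinearMap.apply ℝ ℝ f
  have : LipFree X x₀ ≤ ψ.ker := le_of_delta_mem ψ.isClosed_ker fun p => by
    simp [ψ, hf]
  simpa [ψ, sub_eq_zero] using this hμ

/-- The Schur property of the free space, tested on functionals against Lipschitz functions. -/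
theorem schurProperty_iff : SchurProperty (LipFree X x₀) ↔
    ∀ μ : ℕ → StrongDual ℝ (LipZero X x₀), (∀ n, μ n ∈ LipFree X x₀) →
      (∀ f, Tendsto (fun n => μ n f) atTop (𝓝 0)) → Tendsto μ atTop (𝓝 0) := by
  constructor
  · intro h μ hμ hf
    have := h (fun n => ⟨μ n, hμ n⟩) fun φ => ?_
    · exact tendsto_subtype_rng.1 this
    · obtain ⟨Φ, hΦ, -⟩ := exists_extension_norm_eq (LipFree X x₀) φ
      obtain ⟨f, -, hφ⟩ := exists_apply_eq Φ
      refine (hf f).congr fun n => ?_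
      rw [← hφ _ (hμ n), ← hΦ ⟨μ n, hμ n⟩]
  · intro h v hv
    have := h (fun n => v n) (fun n => (v n).2) fun f =>
      hv ((ContinuousLinearMap.apply ℝ ℝ f).comp (LipFree X x₀).subtypeL)
    exact tendsto_subtype_rng.2 this

/-- Elements of the free space are norm limits of finitely supported ones. -/
theorem exists_finset_approx {μ : StrongDual ℝ (LipZero X x₀)} (hμ : μ ∈ LipFree X x₀) {η : ℝ}
    (hη : 0 < η) : ∃ (ν : StrongDual ℝ (LipZero X x₀)) (F : Finset X) (C : ℝ), 0 ≤ C ∧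
      ‖μ - ν‖ ≤ η ∧ ∀ (f : LipZero X x₀) (ρ : ℝ), 0 ≤ ρ → (∀ x ∈ F, |f x| ≤ ρ) →
        |ν f| ≤ C * ρ := by
  classical
  obtain ⟨ν, hν, hd⟩ := Metric.mem_closure_iff.1 (show μ ∈ closure (Submodule.span ℝ
    (Set.range (delta x₀)) : Set (StrongDual ℝ (LipZero X x₀))) from hμ) η hη
  suffices H : ∃ (F : Finset X) (C : ℝ), 0 ≤ C ∧ ∀ (f : LipZero X x₀) (ρ : ℝ), 0 ≤ ρ →
      (∀ x ∈ F, |f x| ≤ ρ) → |ν f| ≤ C * ρ by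
    obtain ⟨F, C, hC, h⟩ := H
    exact ⟨ν, F, C, hC, by rw [← dist_eq_norm]; exact hd.le, h⟩
  clear hd
  induction hν using Submodule.span_induction with
  | mem x h =>
    obtain ⟨p, rfl⟩ := h
    exact ⟨{p}, 1, zero_le_one, fun f ρ _ h => by simpa using h⟩
  | zero => exact ⟨∅, 0, le_rfl, fun f ρ _ _ => by simp⟩
  | add x y _ _ hx hy =>
    obtain ⟨F, C, hC, h⟩ := hx
    obtain ⟨F', C', hC', h'⟩ := hy
    refine ⟨F ∪ F', C + C', add_nonneg hC hC', fun f ρ hρ hf => ?_⟩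
    have h1 := h f ρ hρ fun x hx => hf x (Finset.mem_union_left _ hx)
    have h2 := h' f ρ hρ fun x hx => hf x (Finset.mem_union_right _ hx)
    rw [add_mul]
    exact (abs_add_le _ _).trans (add_le_add h1 h2)
  | smul a x _ hx =>
    obtain ⟨F, C, hC, h⟩ := hx
    refine ⟨F, |a| * C, mul_nonneg (abs_nonneg _) hC, fun f ρ hρ hf => ?_⟩
    change |a * x f| ≤ _
    rw [abs_mul, mul_assoc]
    exact mul_le_mul_of_nonneg_left (h f ρ hρ hf) (abs_nonneg _)

end LipFree

/-! ### Multiplication by cutoff functions -/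

/-- A bounded Lipschitz weight with bounded support. -/
structure Weight (X : Type*) [MetricSpace X] where
  /-- The underlying function. -/
  toFun : X → ℝ
  nonneg : ∀ x, 0 ≤ toFun x
  le_one : ∀ x, toFun x ≤ 1
  /-- A Lipschitz constant. -/
  lip : ℝ
  lip_nonneg : 0 ≤ lip
  abs_sub_le : ∀ p q, |toFun p - toFun q| ≤ lip * dist p q
  bounded : Bornology.IsBounded {x | toFun x ≠ 0}

namespace Weight

open LipZero

variable {X : Type*} [MetricSpace X] {x₀ : X}

instance : CoeFun (Weight X) (fun _ => X → ℝ) := ⟨toFun⟩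

/-- In the splitting `(f p - f q) * w q + f p * (w p - w q)` the size of `f` enters only at `p`, and
by symmetry `p` can be taken with `w p ≠ 0`. Hence a bound for `f` on the support of `w` suffices.
-/
theorem exists_mul (w : Weight X) (f : LipZero X x₀) {B : ℝ} (hB0 : 0 ≤ B)
    (hB : ∀ x, w x ≠ 0 → |f x| ≤ B) :
    ∃ g : LipZero X x₀, (∀ p, g p = f p * w p) ∧ ‖g‖ ≤ ‖f‖ + B * w.lip := by
  have key : ∀ p q, w p ≠ 0 → |f p * w p - f q * w q| ≤ (‖f‖ + B * w.lip) * dist p q := by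
    intro p q hp
    have h1 : |f p - f q| * |w q| ≤ ‖f‖ * dist p q * 1 :=
      mul_le_mul (LipZero.abs_sub_le f p q) (by rw [abs_of_nonneg (w.nonneg q)]; exact w.le_one q)
        (abs_nonneg _) (by positivity)
    have h2 : |f p| * |w p - w q| ≤ B * (w.lip * dist p q) :=
      mul_le_mul (hB p hp) (w.abs_sub_le p q) (abs_nonneg _) hB0
    calc |f p * w p - f q * w q| = |(f p - f q) * w q + f p * (w p - w q)| := by ring_nf
      _ ≤ |(f p - f q) * w q| + |f p * (w p - w q)| := abs_add_le _ _
      _ ≤ (‖f‖ + B * w.lip) * dist p q := by rw [abs_mul, abs_mul]; linarith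
  refine exists_of_abs_sub_le (g := fun p => f p * w p) (by simp)
    (add_nonneg (norm_nonneg f) (mul_nonneg hB0 w.lip_nonneg)) fun p q => ?_
  by_cases hp : w p = 0
  · by_cases hq : w q = 0
    · simp only [hp, hq, mul_zero, sub_self, abs_zero]
      exact mul_nonneg (add_nonneg (norm_nonneg f) (mul_nonneg hB0 w.lip_nonneg)) dist_nonneg
    · rw [abs_sub_comm, dist_comm]
      exact key q p hq
  · exact key p q hp

theorem exists_mulL (w : Weight X) (x₀ : X) : ∃ A : LipZero X x₀ →L[ℝ] LipZero X x₀,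
    (∀ f p, A f p = f p * w p) ∧
    ∀ (f : LipZero X x₀) (B : ℝ), 0 ≤ B → (∀ x, w x ≠ 0 → |f x| ≤ B) →
      ‖A f‖ ≤ ‖f‖ + B * w.lip := by
  -- Bounded support gives a crude bound, linear in `‖f‖`, that makes the operator continuous; the
  -- finer estimate for an individual `f` follows since the product is unique.
  obtain ⟨R, hR⟩ := w.bounded.subset_closedBall x₀
  have hB : ∀ (f : LipZero X x₀) (x : X), w x ≠ 0 → |f x| ≤ ‖f‖ * max R 0 := fun f x hx =>
    (abs_apply_le f x).trans (mul_le_mul_of_nonneg_left ((hR hx).trans (le_max_left _ _))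
      (norm_nonneg f))
  choose g hg hn using fun f : LipZero X x₀ =>
    w.exists_mul f (mul_nonneg (norm_nonneg f) (le_max_right R 0)) (hB f)
  let L : LipZero X x₀ →ₗ[ℝ] LipZero X x₀ :=
    { toFun := g
      map_add' := fun f f' => LipZero.ext fun p => by simp [hg, add_mul]
      map_smul' := fun c f => LipZero.ext fun p => by simp [hg, mul_assoc] }
  refine ⟨L.mkContinuous (1 + max R 0 * w.lip) fun f => (hn f).trans (by linarith), hg, ?_⟩
  intro f B hB0 hB
  obtain ⟨g', hg', hn'⟩ := w.exists_mul f hB0 hB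
  have : g f = g' := LipZero.ext fun p => by rw [hg, hg']
  change ‖g f‖ ≤ _
  rwa [this]

/-- The weight that is `1` on the `δ`-neighbourhood of `E` and `0` off the `2δ`-neighbourhood. -/
def nhd (E : Set X) (hE : Bornology.IsBounded E) (hne : E.Nonempty) (δ : ℝ) (hδ : 0 < δ) :
    Weight X where
  toFun x := max 0 (min 1 (2 - Metric.infDist x E / δ))
  nonneg x := le_max_left _ _
  le_one x := max_le zero_le_one (min_le_left _ _)
  lip := 1 / δ
  lip_nonneg := by positivity
  abs_sub_le p q := by
    refine (abs_max_sub_max_le_max _ _ _ _).trans ?_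
    rw [sub_self, abs_zero]
    refine max_le (by positivity) ((abs_min_sub_min_le_max _ _ _ _).trans ?_)
    rw [sub_self, abs_zero]
    refine max_le (by positivity) ?_
    have h := (Metric.lipschitz_infDist_pt E).dist_le_mul q p
    rw [Real.dist_eq, NNReal.coe_one, one_mul] at h
    rw [show 2 - Metric.infDist p E / δ - (2 - Metric.infDist q E / δ) =
      (Metric.infDist q E - Metric.infDist p E) / δ by ring, abs_div, abs_of_pos hδ, dist_comm p q,
      one_div, inv_mul_eq_div]
    gcongr
  bounded := by
    refine (hE.thickening (δ := 2 * δ)).subset fun x hx => ?_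
    rw [Metric.mem_thickening_iff]
    rw [← Metric.infDist_lt_iff hne]
    by_contra! hlt
    refine hx (max_eq_left ((min_le_right _ _).trans ?_))
    rw [sub_nonpos, le_div_iff₀ hδ]
    exact hlt

variable {E : Set X} {hE : Bornology.IsBounded E} {hne : E.Nonempty} {δ : ℝ} {hδ : 0 < δ}

theorem nhd_eq_one {x : X} (hx : Metric.infDist x E ≤ δ) : nhd E hE hne δ hδ x = 1 := by
  have : Metric.infDist x E / δ ≤ 1 := (div_le_one hδ).2 hx
  change max 0 (min 1 (2 - Metric.infDist x E / δ)) = 1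
  rw [min_eq_left (by linarith), max_eq_right zero_le_one]

theorem nhd_eq_zero {x : X} (hx : 2 * δ ≤ Metric.infDist x E) : nhd E hE hne δ hδ x = 0 := by
  refine max_eq_left ((min_le_right _ _).trans ?_)
  rw [sub_nonpos, le_div_iff₀ hδ]
  exact hx

end Weight

/-! ### Gliding hump and supports -/

namespace LipFree

open LipZero

variable {X : Type*} [MetricSpace X] {x₀ : X}

/-- The sequence `μ` lies in the free space and converges to zero weakly there. -/
def WeaklyNull (μ : ℕ → StrongDual ℝ (LipZero X x₀)) : Prop :=
  (∀ n, μ n ∈ LipFree X x₀) ∧ ∀ f, Tendsto (fun n => μ n f) atTop (𝓝 0)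

/-- A gliding hump argument: a weakly null sequence is, up to `ε`, uniformly concentrated on some
member of any family of sets which is rich enough for interpolating by humps. -/
theorem WeaklyNull.gliding_hump {μ : ℕ → StrongDual ℝ (LipZero X x₀)} (hμ : WeaklyNull μ)
    {𝒮 : Set (Set X)} (h𝒮 : 𝒮.Nonempty) {𝓕 : Set (LipZero X x₀)} (h𝓕 : ∀ f ∈ 𝓕, ‖f‖ ≤ 1)
    {L : ℝ} (hL : 0 ≤ L)
    (hstep : ∀ S ∈ 𝒮, ∀ F : Finset X, ∃ S' ∈ 𝒮, S ⊆ S' ∧ (F : Set X) ⊆ S' ∧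
      ∀ f ∈ 𝓕, (∀ x ∈ S, f x = 0) → ∃ g : LipZero X x₀, ‖g‖ ≤ L ∧ (∀ x ∈ F, g x = f x) ∧
        (∀ x ∈ S, g x = 0) ∧ ∀ x ∉ S', g x = 0) {ε : ℝ} (hε : 0 < ε) :
    ∃ S ∈ 𝒮, ∀ n, ∀ f ∈ 𝓕, (∀ x ∈ S, f x = 0) → |μ n f| ≤ ε := by
  classical
  obtain ⟨hmem, hnull⟩ := hμ
  by_contra! hbad
  -- The total loss at the end is `ε / 8 + (1 + L) * η + 4 * L * η = ε / 4`, leaving `3 * ε / 4`,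
  -- more than `ε / 2`.
  obtain ⟨η, hη, hηL⟩ : ∃ η : ℝ, 0 < η ∧ η * (1 + 5 * L) = ε / 8 :=
    ⟨ε / 8 / (1 + 5 * L), by positivity, by field_simp⟩
  have hηε : η ≤ ε := by nlinarith [mul_nonneg hη.le hL]
  choose ν F C hC hd hν using fun n => exists_finset_approx (hmem n) hη
  have hsmall : ∀ n (h : LipZero X x₀), (∀ x ∈ F n, h x = 0) → |μ n h| ≤ η * ‖h‖ := by
    intro n h hh
    have h0 : ν n h = 0 := by
      simpa using hν n h 0 le_rfl fun x hx => by simp [hh x hx]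
    have h1 := (μ n - ν n).le_opNorm h
    rw [_root_.sub_apply, h0, sub_zero, Real.norm_eq_abs] at h1
    exact h1.trans (mul_le_mul_of_nonneg_right (hd n) (norm_nonneg h))
  -- The bad index can be forced beyond `N`: enlarge `S` to contain the finite sets of all earlier
  -- indices, on which `hsmall` makes those functionals at most `η ≤ ε`.
  have hbad' : ∀ S ∈ 𝒮, ∀ N : ℕ, ∃ n ≥ N, ∃ f ∈ 𝓕, (∀ x ∈ S, f x = 0) ∧ ε < |μ n f| := by
    intro S hS N
    obtain ⟨S', hS', hSS', hFS', -⟩ := hstep S hS ((Finset.range N).biUnion F)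
    obtain ⟨n, f, hf, hf0, hlt⟩ := hbad S' hS'
    refine ⟨n, ?_, f, hf, fun x hx => hf0 x (hSS' hx), hlt⟩
    by_contra! hn
    have := hsmall n f fun x hx => hf0 x (hFS' (by
      simp only [Finset.coe_biUnion, Set.mem_iUnion]
      exact ⟨n, by simpa using hn, hx⟩))
    nlinarith [h𝓕 f hf]
  -- State: current set, sum of the humps so far, last index used. The decay with constant `L`
  -- towards the complement is what stops Lipschitz constants from accumulating: a pair across the
  -- boundary costs `L` for the old sum and `L` for the new hump.
  let P : Set X × LipZero X x₀ × ℕ → Prop := fun s => s.1 ∈ 𝒮 ∧ (∀ p ∉ s.1, s.2.1 p = 0) ∧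
    (∀ p, ∀ q ∉ s.1, |s.2.1 p| ≤ L * dist p q) ∧ ‖s.2.1‖ ≤ 2 * L
  have step : ∀ s : {s // P s}, ∃ t : {s // P s}, s.1.1 ⊆ t.1.1 ∧ s.1.2.2 < t.1.2.2 ∧
      (F t.1.2.2 : Set X) ⊆ t.1.1 ∧ (∀ x ∈ s.1.1, t.1.2.1 x = s.1.2.1 x) ∧
      ε - ε / 8 - (1 + L) * η ≤ |μ t.1.2.2 t.1.2.1| := by
    rintro ⟨⟨S, Γ, m⟩, hS, hΓ0, hΓL, hΓn⟩
    obtain ⟨N, hN⟩ := (Metric.tendsto_atTop.1 (hnull Γ)) (ε / 8) (by positivity)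
    obtain ⟨n, hn, f, hf, hf0, hlt⟩ := hbad' S hS (max N (m + 1))
    obtain ⟨S', hS', hSS', hFS', hg⟩ := hstep S hS (F n)
    obtain ⟨g, hgL, hgF, hgS, hgS'⟩ := hg f hf hf0
    have hsum : ∀ p, ∀ q ∉ S', |(Γ + g) p| ≤ L * dist p q := by
      intro p q hq
      by_cases hp : p ∈ S
      · simpa [hgS p hp] using hΓL p q fun h => hq (hSS' h)
      · have := LipZero.abs_sub_le g p q
        rw [hgS' q hq, sub_zero] at this
        rw [LipZero.add_apply, hΓ0 p hp, zero_add]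
        exact this.trans (mul_le_mul_of_nonneg_right hgL dist_nonneg)
    have hmix : ∀ p ∈ S, ∀ q ∉ S, |(Γ + g) p - (Γ + g) q| ≤ 2 * L * dist p q := by
      intro p hp q hq
      have h1 := LipZero.abs_sub_le g p q
      have h2 := hΓL p q hq
      have h3 : ‖g‖ * dist p q ≤ L * dist p q := mul_le_mul_of_nonneg_right hgL dist_nonneg
      rw [hgS p hp, zero_sub, abs_neg] at h1
      rw [LipZero.add_apply, LipZero.add_apply, hgS p hp, hΓ0 q hq, add_zero, zero_add]
      linarith [abs_sub (Γ p) (g q)]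
    have hnorm : ‖Γ + g‖ ≤ 2 * L := by
      refine LipZero.norm_le _ (by positivity) fun p q => ?_
      by_cases hp : p ∈ S <;> by_cases hq : q ∈ S
      · have := LipZero.abs_sub_le Γ p q
        rw [LipZero.add_apply, LipZero.add_apply, hgS p hp, hgS q hq, add_zero, add_zero]
        exact this.trans (mul_le_mul_of_nonneg_right hΓn dist_nonneg)
      · exact hmix p hp q hq
      · rw [abs_sub_comm, dist_comm]
        exact hmix q hq p hp
      · have := LipZero.abs_sub_le g p q
        rw [LipZero.add_apply, LipZero.add_apply, hΓ0 p hp, hΓ0 q hq, zero_add, zero_add]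
        exact this.trans (mul_le_mul_of_nonneg_right (by linarith) dist_nonneg)
    refine ⟨⟨⟨S', Γ + g, n⟩, hS', fun p hp => ?_, hsum, hnorm⟩, hSS',
      lt_of_lt_of_le (Nat.lt_succ_self m) ((le_max_right _ _).trans hn), hFS', fun x hx => ?_, ?_⟩
    · change Γ p + g p = 0
      rw [hΓ0 p fun h => hp (hSS' h), hgS' p hp, add_zero]
    · change Γ x + g x = Γ x
      rw [hgS x hx, add_zero]
    · change _ ≤ |μ n (Γ + g)|
      have h1 := hN n ((le_max_left _ _).trans hn)
      rw [Real.dist_eq, sub_zero] at h1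
      have h2 := hsmall n (f - g) fun x hx => by simp [hgF x hx]
      have h3 : η * ‖f - g‖ ≤ η * (1 + L) := mul_le_mul_of_nonneg_left
        ((norm_sub_le f g).trans (add_le_add (h𝓕 f hf) hgL)) hη.le
      have h4 : |μ n f| ≤ |μ n (Γ + g)| + |μ n Γ| + |μ n (f - g)| := by
        -- `μ n Γ` is small because `n` is late, and `μ n (f - g)` because `g` agrees with `f` on `F
        -- n`.
        rw [show μ n f = μ n (Γ + g) - μ n Γ + μ n (f - g) by rw [map_add, map_sub]; ring]
        exact (abs_add_le _ _).trans (add_le_add (abs_sub _ _) le_rfl)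
      linarith
  obtain ⟨S₀, hS₀⟩ := h𝒮
  choose next hnext using step
  let s : ℕ → {s // P s} := fun k => Nat.rec
    ⟨⟨S₀, 0, 0⟩, hS₀, fun _ _ => rfl, fun p q _ => by
      simpa using mul_nonneg hL dist_nonneg, by simpa using hL⟩ (fun _ t => next t) k
  have hs : ∀ k, s (k + 1) = next (s k) := fun _ => rfl
  have hmono : Monotone fun k => (s k).1.1 := monotone_nat_of_le_succ fun k => (hnext (s k)).1
  have hconst : ∀ k, ∀ x ∈ (s k).1.1, ∀ j ≥ k, (s j).1.2.1 x = (s k).1.2.1 x := by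
    intro k x hx j hj
    induction j, hj using Nat.le_induction with
    | base => rfl
    | succ j hj ih => rw [← ih, hs, (hnext (s j)).2.2.2.1 x (hmono hj hx)]
  -- The partial sums stabilise at every point: they freeze once `x` is captured, and vanish at `x`
  -- if it never is.
  have hlim : ∀ x, ∃ y : ℝ, ∀ᶠ k in atTop, (s k).1.2.1 x = y := by
    intro x
    by_cases hx : ∃ k, x ∈ (s k).1.1
    · obtain ⟨k, hk⟩ := hx
      exact ⟨_, eventually_atTop.2 ⟨k, hconst k x hk⟩⟩
    · push Not at hx
      exact ⟨0, Eventually.of_forall fun k => (s k).2.2.1 x (hx k)⟩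
  choose G₀ hG₀ using hlim
  obtain ⟨G, hG, hGn⟩ := exists_of_abs_sub_le (x₀ := x₀) (g := G₀) (C := 2 * L) (by
      obtain ⟨k, hk⟩ := (hG₀ x₀).exists
      rw [← hk, apply_basepoint]) (by positivity) (fun p q => by
      obtain ⟨k, hp, hq⟩ := ((hG₀ p).and (hG₀ q)).exists
      rw [← hp, ← hq]
      exact (LipZero.abs_sub_le _ p q).trans
        (mul_le_mul_of_nonneg_right (s k).2.2.2.2 dist_nonneg))
  have hGs : ∀ k, ∀ x ∈ (s k).1.1, G x = (s k).1.2.1 x := by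
    intro k x hx
    obtain ⟨j, hj, hkj⟩ := ((hG₀ x).and (eventually_ge_atTop k)).exists
    rw [hG, ← hj, hconst k x hx j hkj]
  have hgrow : StrictMono fun k => (s k).1.2.2 := strictMono_nat_of_lt_succ fun k =>
    (hnext (s k)).2.1
  obtain ⟨N, hN⟩ := (Metric.tendsto_atTop.1 (hnull G)) (ε / 2) (by positivity)
  have h1 := hN (s (N + 1)).1.2.2 ((Nat.le_succ N).trans (hgrow.le_apply (x := N + 1)))
  rw [Real.dist_eq, sub_zero] at h1
  have h2 := (hnext (s N)).2.2.2.2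
  rw [← hs] at h2
  have hF := (hnext (s N)).2.2.1
  rw [← hs] at hF
  have h3 := hsmall _ ((s (N + 1)).1.2.1 - G) fun x hx => by
    rw [LipZero.sub_apply, hGs (N + 1) x (hF hx), sub_self]
  have h4 : η * ‖(s (N + 1)).1.2.1 - G‖ ≤ η * (2 * L + 2 * L) := mul_le_mul_of_nonneg_left
    ((norm_sub_le _ _).trans (add_le_add (s (N + 1)).2.2.2.2 hGn)) hη.le
  rw [map_sub] at h3
  have h5 := abs_sub_abs_le_abs_sub (μ (s (N + 1)).1.2.2 (s (N + 1)).1.2.1)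
    (μ (s (N + 1)).1.2.2 G)
  linarith

/-- The functional `μ` only depends on the values of Lipschitz functions on `S`. -/
def SupportedOn (S : Set X) (μ : StrongDual ℝ (LipZero X x₀)) : Prop :=
  ∀ f : LipZero X x₀, (∀ x ∈ S, f x = 0) → μ f = 0

theorem SupportedOn.apply_eq {S : Set X} {μ : StrongDual ℝ (LipZero X x₀)} (h : SupportedOn S μ)
    {f g : LipZero X x₀} (hfg : ∀ x ∈ S, f x = g x) : μ f = μ g := by
  rw [← sub_eq_zero, ← map_sub]
  exact h _ fun x hx => by simp [hfg x hx]

theorem SupportedOn.mono {S T : Set X} (hST : S ⊆ T) {μ : StrongDual ℝ (LipZero X x₀)}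
    (h : SupportedOn S μ) : SupportedOn T μ := fun f hf => h f fun x hx => hf x (hST hx)

/-- Composition with multiplication by a weight. -/
theorem WeaklyNull.comp_weight {μ : ℕ → StrongDual ℝ (LipZero X x₀)} (hμ : WeaklyNull μ)
    {w : Weight X} {A : LipZero X x₀ →L[ℝ] LipZero X x₀} (hA : ∀ f p, A f p = f p * w p) :
    WeaklyNull fun n => (μ n).comp A := by
  refine ⟨fun n => comp_mem A (fun p => ?_) (hμ.1 n), fun f => hμ.2 (A f)⟩
  have : (delta x₀ p).comp A = w p • delta x₀ p := by
    ext f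
    simp [hA, mul_comm]
  rw [this]
  exact Submodule.smul_mem _ _ (delta_mem p)

theorem SupportedOn.comp_weight {S T : Set X} {μ : StrongDual ℝ (LipZero X x₀)}
    (h : SupportedOn S μ) {w : Weight X} {A : LipZero X x₀ →L[ℝ] LipZero X x₀}
    (hA : ∀ f p, A f p = f p * w p) (hw : ∀ x ∉ T, w x = 0) : SupportedOn (S ∩ T) (μ.comp A) := by
  intro f hf
  refine h (A f) fun x hx => ?_
  rw [hA]
  by_cases hT : x ∈ T
  · rw [hf x ⟨hx, hT⟩, zero_mul]
  · rw [hw x hT, mul_zero]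

/-! ### Concentration on bounded sets and near finite sets -/

/-- Weakly null sequences are uniformly approximable by boundedly supported ones. -/
theorem WeaklyNull.exists_bounded {μ : ℕ → StrongDual ℝ (LipZero X x₀)} (hμ : WeaklyNull μ)
    {ε : ℝ} (hε : 0 < ε) : ∃ ν : ℕ → StrongDual ℝ (LipZero X x₀), WeaklyNull ν ∧
      (∀ n, ‖μ n - ν n‖ ≤ ε) ∧ ∃ R > 0, ∀ n, SupportedOn (Metric.closedBall x₀ R) (ν n) := by
  have hb : Bornology.IsBounded {x₀} := Bornology.isBounded_singleton
  -- Since `f x₀ = 0`, `f` is at most `2 * r * ‖f‖` on the support, while the weight is `1 /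
  -- r`-Lipschitz. The product `2 * ‖f‖` does not depend on `r`, whence `L = 3`.
  have hbd : ∀ {r : ℝ} (hr : 0 < r) (f : LipZero X x₀), ∀ x,
      Weight.nhd {x₀} hb (Set.singleton_nonempty x₀) r hr x ≠ 0 → |f x| ≤ ‖f‖ * (2 * r) := by
    intro r hr f x hx
    refine (abs_apply_le f x).trans (mul_le_mul_of_nonneg_left ?_ (norm_nonneg f))
    by_contra! hlt
    exact hx (Weight.nhd_eq_zero (by rw [Metric.infDist_singleton]; exact hlt.le))
  have hlip : ∀ {r : ℝ} (hr : 0 < r),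
      (Weight.nhd {x₀} hb (Set.singleton_nonempty x₀) r hr).lip = 1 / r := fun _ => rfl
  obtain ⟨S, ⟨r, hr, rfl⟩, hS⟩ := hμ.gliding_hump
    (𝒮 := {S | ∃ r : ℝ, 0 < r ∧ S = Metric.closedBall x₀ r}) ⟨_, 1, one_pos, rfl⟩
    (𝓕 := {f | ‖f‖ ≤ 1}) (fun f hf => hf) (L := 3) (by norm_num) (by
      rintro _ ⟨r, hr, rfl⟩ F
      obtain ⟨r₁, hr₁⟩ := F.finite_toSet.isBounded.subset_closedBall x₀
      have hr' : 0 < max r r₁ := lt_max_of_lt_left hr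
      refine ⟨_, ⟨2 * max r r₁, by positivity, rfl⟩, Metric.closedBall_subset_closedBall
        (by linarith [le_max_left r r₁]), hr₁.trans (Metric.closedBall_subset_closedBall
        (by linarith [le_max_right r r₁])), fun f hf hf0 => ?_⟩
      obtain ⟨g, hg, hgn⟩ := (Weight.nhd {x₀} hb (Set.singleton_nonempty x₀) _ hr').exists_mul f
        (by positivity) (hbd hr' f)
      refine ⟨g, hgn.trans ?_, fun x hx => ?_, fun x hx => ?_, fun x hx => ?_⟩
      · rw [hlip]
        have : ‖f‖ * (2 * max r r₁) * (1 / max r r₁) = 2 * ‖f‖ := by field_simp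
        have hf1 : ‖f‖ ≤ 1 := hf
        linarith
      · rw [hg, Weight.nhd_eq_one, mul_one]
        rw [Metric.infDist_singleton]
        exact (hr₁ hx).trans (le_max_right _ _)
      · rw [hg, hf0 x hx, zero_mul]
      · rw [hg, Weight.nhd_eq_zero, mul_zero]
        rw [Metric.infDist_singleton]
        rw [Metric.mem_closedBall, not_le] at hx
        exact hx.le)
    (show 0 < ε / 4 by positivity)
  obtain ⟨A, hA, hAn⟩ :=
    (Weight.nhd {x₀} hb (Set.singleton_nonempty x₀) r hr).exists_mulL x₀
  refine ⟨fun n => (μ n).comp A, hμ.comp_weight hA, fun n => ?_, 2 * r, by positivity,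
    fun n => ?_⟩
  · refine ContinuousLinearMap.opNorm_le_of_unit_norm hε.le fun f hf => ?_
    have hAf : ‖A f‖ ≤ 3 := by
      refine (hAn f _ (by positivity) (hbd hr f)).trans ?_
      rw [hlip, hf]
      have : 1 * (2 * r) * (1 / r) = 2 := by field_simp
      linarith
    -- `f - A f` vanishes on the concentration ball and has norm at most `1 + 3`.
    have h := hS n ((1 / 4 : ℝ) • (f - A f)) (by
      have := norm_sub_le f (A f)
      simp only [Set.mem_ofPred_eq, norm_smul]
      norm_num
      linarith) (fun x hx => by
        rw [LipZero.smul_apply, LipZero.sub_apply, hA, Weight.nhd_eq_one, mul_one, sub_self,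
          mul_zero]
        rw [Metric.infDist_singleton]
        exact hx)
    rw [map_smul, map_sub, smul_eq_mul, abs_mul, abs_of_pos (by norm_num : (0 : ℝ) < 1 / 4)] at h
    change |μ n f - μ n (A f)| ≤ ε
    linarith
  · refine SupportedOn.mono Set.inter_subset_right (S := Set.univ ∩ _)
      (SupportedOn.comp_weight (S := Set.univ) ?_ hA fun x hx => ?_)
    · intro f hf
      rw [show f = 0 from LipZero.ext fun p => hf p trivial, map_zero]
    · refine Weight.nhd_eq_zero ?_
      rw [Metric.infDist_singleton]
      rw [Metric.mem_closedBall, not_le] at hx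
      exact hx.le

/-- A boundedly supported weakly null sequence is uniformly approximable by one that lives near a
finite set. -/
theorem WeaklyNull.exists_near_finite {μ : ℕ → StrongDual ℝ (LipZero X x₀)} (hμ : WeaklyNull μ)
    {R : ℝ} (hR : 0 < R) (hsupp : ∀ n, SupportedOn (Metric.closedBall x₀ R) (μ n))
    {δ : ℝ} (hδ : 0 < δ) {ε : ℝ} (hε : 0 < ε) :
    ∃ ν : ℕ → StrongDual ℝ (LipZero X x₀), WeaklyNull ν ∧ (∀ n, ‖μ n - ν n‖ ≤ ε) ∧
      ∃ E : Finset X, x₀ ∈ E ∧ ∀ n S, SupportedOn S (μ n) →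
        SupportedOn (S ∩ {x | Metric.infDist x E ≤ 2 * δ}) (ν n) := by
  classical
  have hb : ∀ E : Finset X, Bornology.IsBounded (E : Set X) := fun E => E.finite_toSet.isBounded
  set C : ℝ := 1 + (1 + R * (1 / δ)) with hCdef
  have hC : 1 ≤ C := by
    have : 0 ≤ R * (1 / δ) := by positivity
    linarith
  -- The bound `R` on the test functions makes `L` independent of the finite set. Humps are cut at
  -- scale `δ / 2` so that they vanish off the `δ`-neighbourhood; the final cutoff has scale `δ` so
  -- that it equals `1` there.
  obtain ⟨_, ⟨E, hE, rfl⟩, hS⟩ := hμ.gliding_hump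
    (𝒮 := {S | ∃ E : Finset X, x₀ ∈ E ∧ S = {x | Metric.infDist x E ≤ δ}})
    ⟨_, {x₀}, Finset.mem_singleton_self _, rfl⟩
    (𝓕 := {f | ‖f‖ ≤ 1 ∧ ∀ x, |f x| ≤ R}) (fun f hf => hf.1) (L := 1 + R * (1 / (δ / 2)))
    (by positivity) (by
      rintro _ ⟨E, hE, rfl⟩ F
      have hne : ((E ∪ F : Finset X) : Set X).Nonempty := ⟨x₀, Finset.mem_union_left _ hE⟩
      refine ⟨_, ⟨E ∪ F, Finset.mem_union_left _ hE, rfl⟩, fun x hx => ?_, fun x hx => ?_,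
        fun f hf hf0 => ?_⟩
      · exact (Metric.infDist_le_infDist_of_subset
          (Finset.coe_subset.2 Finset.subset_union_left) ⟨x₀, hE⟩).trans hx
      · change Metric.infDist x _ ≤ δ
        rw [Metric.infDist_zero_of_mem (Finset.mem_coe.2 (Finset.mem_union_right _ hx))]
        exact hδ.le
      obtain ⟨g, hg, hgn⟩ := (Weight.nhd _ (hb (E ∪ F)) hne (δ / 2) (by positivity)).exists_mul f
        hR.le (fun x _ => hf.2 x)
      refine ⟨g, hgn.trans (add_le_add hf.1 le_rfl), fun x hx => ?_, fun x hx => ?_,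
        fun x hx => ?_⟩
      · rw [hg, Weight.nhd_eq_one, mul_one]
        rw [Metric.infDist_zero_of_mem (Finset.mem_coe.2 (Finset.mem_union_right _ hx))]
        positivity
      · rw [hg, hf0 x hx, zero_mul]
      · rw [hg, Weight.nhd_eq_zero, mul_zero]
        rw [Set.mem_ofPred_eq, not_le] at hx
        linarith)
    (show 0 < ε / C by positivity)
  have hne : (E : Set X).Nonempty := ⟨x₀, hE⟩
  obtain ⟨A, hA, hAn⟩ := (Weight.nhd _ (hb E) hne δ hδ).exists_mulL x₀
  refine ⟨fun n => (μ n).comp A, hμ.comp_weight hA, fun n => ?_, E, hE, fun n S hS => ?_⟩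
  · refine ContinuousLinearMap.opNorm_le_of_unit_norm hε.le fun f hf => ?_
    -- On the ball carrying `μ n` one has `|f| ≤ R`, so truncating `f` at `R` is invisible to `μ n`.
    obtain ⟨g, hgf, hgR, hg⟩ := exists_truncation f hR.le
    rw [hf] at hgf
    have hfg : ∀ x ∈ Metric.closedBall x₀ R, f x = g x := fun x hx =>
      (hg x ((abs_apply_le f x).trans (by rw [hf, one_mul]; exact hx))).symm
    have h1 : μ n f = μ n g := (hsupp n).apply_eq hfg
    have h2 : μ n (A f) = μ n (A g) :=
      (hsupp n).apply_eq fun x hx => by rw [hA, hA, hfg x hx]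
    have hAg : ‖A g‖ ≤ 1 + R * (1 / δ) :=
      (hAn g R hR.le fun x _ => hgR x).trans (add_le_add hgf le_rfl)
    have h := hS n ((1 / C) • (g - A g)) ⟨by
        rw [norm_smul, Real.norm_of_nonneg (by positivity), one_div, inv_mul_le_one₀ (by positivity)]
        exact (norm_sub_le _ _).trans (add_le_add hgf hAg), fun x => by
        rw [LipZero.smul_apply, LipZero.sub_apply, hA, abs_mul, abs_of_pos (by positivity)]
        have hw0 := (Weight.nhd _ (hb E) hne δ hδ).nonneg x
        have hw1 := (Weight.nhd _ (hb E) hne δ hδ).le_one x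
        rw [show ∀ a b : ℝ, a - a * b = a * (1 - b) by intros; ring, abs_mul]
        have h3 : |1 - (Weight.nhd _ (hb E) hne δ hδ) x| ≤ 1 := by
          rw [abs_of_nonneg (by linarith)]
          linarith
        have h4 : 1 / C ≤ 1 := (div_le_one (by positivity)).2 hC
        calc _ ≤ 1 * (R * 1) := by gcongr; exact hgR x
          _ = R := by ring⟩ (fun x hx => by
        rw [LipZero.smul_apply, LipZero.sub_apply, hA, Weight.nhd_eq_one hx, mul_one, sub_self,
          mul_zero])
    rw [map_smul, map_sub, smul_eq_mul, abs_mul, abs_of_pos (by positivity), one_div_mul_eq_div,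
      div_le_div_iff_of_pos_right (by positivity)] at h
    change |μ n f - μ n (A f)| ≤ ε
    rwa [h1, h2]
  · refine hS.comp_weight hA fun x hx => Weight.nhd_eq_zero ?_
    rw [Set.mem_ofPred_eq, not_le] at hx
    exact hx.le

end LipFree

/-! ### Nested closed sets with finite nets -/

section NestedSets

variable {X : Type*} [MetricSpace X] [CompleteSpace X] {S : ℕ → Set X}

/-- An ultrafilter containing a finite union of small balls contains one of them, so it is Cauchy.
-/
theorem Ultrafilter.exists_le_nhds_of_forall_mem
    (hcov : ∀ ε > 0, ∃ i, ∃ E : Finset X, S i ⊆ ⋃ e ∈ (E : Set X), Metric.ball e ε)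
    (u : Ultrafilter X) (hu : ∀ i, S i ∈ u) : ∃ x, (u : Filter X) ≤ 𝓝 x := by
  refine CompleteSpace.complete (Metric.cauchy_iff.2 ⟨u.neBot, fun ε hε => ?_⟩)
  obtain ⟨i, E, hE⟩ := hcov (ε / 2) (by positivity)
  obtain ⟨e, -, he⟩ := (Ultrafilter.finite_biUnion_mem_iff E.finite_toSet).1
    (mem_of_superset (hu i) hE)
  refine ⟨_, he, fun x hx y hy => ?_⟩
  rw [Metric.mem_ball] at hx hy
  linarith [dist_triangle_right x y e]

theorem isCompact_iInter_of_finite_nets (hcl : ∀ i, IsClosed (S i))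
    (hcov : ∀ ε > 0, ∃ i, ∃ E : Finset X, S i ⊆ ⋃ e ∈ (E : Set X), Metric.ball e ε) :
    IsCompact (⋂ i, S i) := by
  refine isCompact_iff_ultrafilter_le_nhds.2 fun u hu => ?_
  have hu' := le_principal_iff.1 hu
  obtain ⟨x, hx⟩ := u.exists_le_nhds_of_forall_mem hcov
    fun i => mem_of_superset hu' (Set.iInter_subset S i)
  exact ⟨x, isClosed_iff_ultrafilter.1 (isClosed_iInter hcl) x u hx hu', hx⟩

/-- A Dini-type argument: otherwise the closed sets `S i ∩ {x | ρ ≤ |f x|}` are nonempty and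
decreasing, and an ultrafilter through all of them converges to a point of the intersection where
`f` is nonzero. -/
theorem exists_forall_abs_lt_of_finite_nets (hcl : ∀ i, IsClosed (S i)) (hanti : Antitone S)
    (hcov : ∀ ε > 0, ∃ i, ∃ E : Finset X, S i ⊆ ⋃ e ∈ (E : Set X), Metric.ball e ε)
    {f : X → ℝ} (hf : Continuous f) (hf0 : ∀ x ∈ ⋂ i, S i, f x = 0) {ρ : ℝ} (hρ : 0 < ρ) :
    ∃ i, ∀ x ∈ S i, |f x| < ρ := by
  by_contra! hbad
  let C : ℕ → Set X := fun i => S i ∩ {x | ρ ≤ |f x|}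
  have hC : ∀ i, IsClosed (C i) := fun i =>
    (hcl i).inter (isClosed_le continuous_const hf.abs)
  have hne : (⨅ i, 𝓟 (C i)).NeBot := by
    refine iInf_neBot_of_directed' (Antitone.directed_ge fun i j hij => ?_) fun i => ?_
    · exact principal_mono.2 (Set.inter_subset_inter_left _ (hanti hij))
    · exact principal_neBot_iff.2 (hbad i)
  let u := Ultrafilter.of (⨅ i, 𝓟 (C i))
  have hu : ∀ i, C i ∈ u := fun i =>
    le_principal_iff.1 ((Ultrafilter.of_le _).trans (iInf_le _ i))
  obtain ⟨x, hx⟩ := u.exists_le_nhds_of_forall_mem hcov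
    fun i => mem_of_superset (hu i) Set.inter_subset_left
  have hxC : ∀ i, x ∈ C i := fun i => isClosed_iff_ultrafilter.1 (hC i) x u hx (hu i)
  have h0 := hf0 x (Set.mem_iInter.2 fun i => (hxC i).1)
  have h1 : ρ ≤ |f x| := (hxC 0).2
  rw [h0, abs_zero] at h1
  linarith

end NestedSets

/-! ### Limits of supports and the compact reduction -/

namespace LipFree

open LipZero

variable {X : Type*} [MetricSpace X] {x₀ : X}

theorem WeaklyNull.of_uniform_limit {μ : ℕ → StrongDual ℝ (LipZero X x₀)}
    (h : ∀ ε > 0, ∃ ν : ℕ → StrongDual ℝ (LipZero X x₀), WeaklyNull ν ∧ ∀ n, ‖μ n - ν n‖ ≤ ε) :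
    WeaklyNull μ := by
  refine ⟨fun n => ?_, fun f => ?_⟩
  · refine isClosed.closure_subset (Metric.mem_closure_iff.2 fun ε hε => ?_)
    obtain ⟨ν, hν, hd⟩ := h (ε / 2) (by positivity)
    refine ⟨ν n, hν.1 n, ?_⟩
    rw [dist_eq_norm]
    linarith [hd n]
  · rw [Metric.tendsto_atTop]
    intro ε hε
    obtain ⟨ν, hν, hd⟩ := h (ε / 2 / (‖f‖ + 1)) (by positivity)
    obtain ⟨N, hN⟩ := Metric.tendsto_atTop.1 (hν.2 f) (ε / 2) (by positivity)
    refine ⟨N, fun n hn => ?_⟩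
    have h1 := hN n hn
    have h2 := ((μ n - ν n).le_opNorm f).trans
      (mul_le_mul (hd n) (le_add_of_nonneg_right zero_le_one) (norm_nonneg f) (by positivity))
    rw [div_mul_cancel₀ _ (by positivity), _root_.sub_apply, Real.norm_eq_abs] at h2
    rw [Real.dist_eq, sub_zero] at h1 ⊢
    have h3 := abs_sub_abs_le_abs_sub (μ n f) (ν n f)
    linarith

theorem SupportedOn.of_limit {S : Set X} {μ : StrongDual ℝ (LipZero X x₀)}
    (h : ∀ ε > 0, ∃ ν, SupportedOn S ν ∧ ‖μ - ν‖ ≤ ε) : SupportedOn S μ := by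
  intro f hf
  refine abs_nonpos_iff.1 (le_of_forall_pos_le_add fun ε hε => ?_)
  obtain ⟨ν, hν, hd⟩ := h (ε / (‖f‖ + 1)) (by positivity)
  have h2 := ((μ - ν).le_opNorm f).trans
    (mul_le_mul hd (le_add_of_nonneg_right zero_le_one) (norm_nonneg f) (by positivity))
  rw [div_mul_cancel₀ _ (by positivity), _root_.sub_apply, hν f hf, sub_zero] at h2
  rwa [zero_add]

/-- If an element of the free space is supported on each member of a decreasing sequence of closed
sets admitting finite `ε`-nets with `ε` tending to zero, then it is supported on the
intersection. -/
theorem SupportedOn.iInter [CompleteSpace X] {S : ℕ → Set X} (hcl : ∀ i, IsClosed (S i))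
    (hanti : Antitone S)
    (hcov : ∀ ε > 0, ∃ i, ∃ E : Finset X, S i ⊆ ⋃ e ∈ (E : Set X), Metric.ball e ε)
    {μ : StrongDual ℝ (LipZero X x₀)} (hμ : μ ∈ LipFree X x₀) (h : ∀ i, SupportedOn (S i) μ) :
    SupportedOn (⋂ i, S i) μ := by
  intro f hf
  refine abs_nonpos_iff.1 (le_of_forall_pos_le_add fun ε hε => ?_)
  obtain ⟨ν, F, C, hC, hd, hν⟩ :=
    exists_finset_approx hμ (show 0 < ε / 2 / (‖f‖ + 1) by positivity)
  have hρ : 0 < ε / 2 / (C + 1) := by positivity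
  obtain ⟨i, hi⟩ := exists_forall_abs_lt_of_finite_nets hcl hanti hcov f.continuous hf hρ
  -- Truncation leaves `f` unchanged on `S i`, hence `μ f = μ g`, and makes it small at every point
  -- of `F`, even those outside `S i`.
  obtain ⟨g, hgn, hgρ, hg⟩ := exists_truncation f hρ.le
  rw [(h i).apply_eq fun x hx => (hg x (hi x hx).le).symm]
  have h1 := hν g _ hρ.le fun x _ => hgρ x
  have h2 := ((μ - ν).le_opNorm g).trans
    (mul_le_mul hd (hgn.trans (le_add_of_nonneg_right zero_le_one)) (norm_nonneg g)
      (by positivity))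
  rw [div_mul_cancel₀ _ (by positivity), _root_.sub_apply, Real.norm_eq_abs] at h2
  have h3 := abs_sub_abs_le_abs_sub (μ g) (ν g)
  have h4 : C * (ε / 2 / (C + 1)) ≤ (C + 1) * (ε / 2 / (C + 1)) := by gcongr; linarith
  rw [mul_div_cancel₀ _ (by positivity)] at h4
  linarith

/-- Compact reduction: a weakly null sequence is uniformly approximable by weakly null sequences
supported on a compact set. -/
theorem WeaklyNull.exists_compact [CompleteSpace X] {μ : ℕ → StrongDual ℝ (LipZero X x₀)}
    (hμ : WeaklyNull μ) {ε : ℝ} (hε : 0 < ε) :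
    ∃ ν : ℕ → StrongDual ℝ (LipZero X x₀), WeaklyNull ν ∧ (∀ n, ‖μ n - ν n‖ ≤ ε) ∧
      ∃ K : Set X, IsCompact K ∧ x₀ ∈ K ∧ ∀ n, SupportedOn K (ν n) := by
  obtain ⟨μ', hμ', hd', R, hR, hsupp⟩ := hμ.exists_bounded (show 0 < ε / 2 by positivity)
  let P : (ℕ → StrongDual ℝ (LipZero X x₀)) × Set X → Prop := fun s => WeaklyNull s.1 ∧
    IsClosed s.2 ∧ x₀ ∈ s.2 ∧ s.2 ⊆ Metric.closedBall x₀ R ∧ ∀ n, SupportedOn s.2 (s.1 n)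
  have step : ∀ (i : ℕ) (s : {s // P s}), ∃ t : {s // P s}, t.1.2 ⊆ s.1.2 ∧
      (∀ n, ‖s.1.1 n - t.1.1 n‖ ≤ ε / 2 / 2 / 2 ^ i) ∧
      ∃ E : Finset X, t.1.2 ⊆ ⋃ e ∈ (E : Set X), Metric.ball e (1 / ((i : ℝ) + 1)) := by
    rintro i ⟨⟨ν, S⟩, hν, hScl, hxS, hSR, hS⟩
    have hi : (0 : ℝ) < 1 / ((i : ℝ) + 1) := by positivity
    -- The errors sum to `ε / 2`, the other half being spent on boundedness. With this `δ`, `2 * δ`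
    -- is strictly below the radius of the open balls of the net.
    obtain ⟨ν', hν', hd, E, hE, hsupp'⟩ := hν.exists_near_finite hR (fun n => (hS n).mono hSR)
      (show 0 < 1 / ((i : ℝ) + 1) / 4 by positivity) (show 0 < ε / 2 / 2 / 2 ^ i by positivity)
    refine ⟨⟨⟨ν', S ∩ _⟩, hν', hScl.inter (isClosed_le (Metric.continuous_infDist_pt _)
      continuous_const), ⟨hxS, ?_⟩, Set.inter_subset_left.trans hSR, fun n => hsupp' n S (hS n)⟩,
      Set.inter_subset_left, hd, E, fun x hx => ?_⟩
    · rw [Set.mem_ofPred_eq, Metric.infDist_zero_of_mem (Finset.mem_coe.2 hE)]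
      positivity
    · have hx' : Metric.infDist x E ≤ 2 * (1 / ((i : ℝ) + 1) / 4) := hx.2
      obtain ⟨e, he, hxe⟩ := (Metric.infDist_lt_iff (s := (E : Set X)) ⟨x₀, hE⟩
        (r := 1 / ((i : ℝ) + 1))).1 (hx'.trans_lt (by
          generalize 1 / ((i : ℝ) + 1) = r at hi
          linarith))
      exact Set.mem_iUnion₂.2 ⟨e, he, hxe⟩
  choose next hsub hdist hnet using step
  let s : ℕ → {s // P s} := fun k => Nat.rec ⟨⟨μ', Metric.closedBall x₀ R⟩, hμ',
    Metric.isClosed_closedBall, Metric.mem_closedBall_self hR.le, subset_rfl, hsupp⟩ next k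
  have hanti : Antitone fun k => (s k).1.2 := antitone_nat_of_succ_le fun k => hsub k (s k)
  have hcov : ∀ r > 0, ∃ i, ∃ E : Finset X,
      (s i).1.2 ⊆ ⋃ e ∈ (E : Set X), Metric.ball e r := by
    intro r hr
    obtain ⟨k, hk⟩ := exists_nat_one_div_lt hr
    obtain ⟨E, hE⟩ := hnet k (s k)
    exact ⟨k + 1, E, hE.trans (Set.iUnion₂_mono fun e _ => Metric.ball_subset_ball hk.le)⟩
  have hgeom : ∀ n k, dist ((s k).1.1 n) ((s (k + 1)).1.1 n) ≤ ε / 2 / 2 / 2 ^ k := fun n k => by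
    rw [dist_eq_norm]
    exact hdist k (s k) n
  choose ν hν using fun n => cauchySeq_tendsto_of_complete (cauchySeq_of_le_geometric_two (hgeom n))
  have hclose : ∀ k n, ‖ν n - (s k).1.1 n‖ ≤ ε / 2 / 2 ^ k := fun k n => by
    rw [← dist_eq_norm, dist_comm]
    exact dist_le_of_le_geometric_two_of_tendsto (hgeom n) (hν n) k
  have hlarge : ∀ r > 0, ∀ i, ∃ k ≥ i, ε / 2 / 2 ^ k ≤ r := by
    intro r hr i
    have ht : Tendsto (fun k : ℕ => ε / 2 / 2 ^ k) atTop (𝓝 0) :=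
      tendsto_const_nhds.div_atTop (tendsto_pow_atTop_atTop_of_one_lt one_lt_two)
    obtain ⟨k, hk, hik⟩ := ((ht.eventually_le_const hr).and (eventually_ge_atTop i)).exists
    exact ⟨k, hik, hk⟩
  have hνnull : WeaklyNull ν := WeaklyNull.of_uniform_limit fun r hr => by
    obtain ⟨k, -, hk⟩ := hlarge r hr 0
    exact ⟨_, (s k).2.1, fun n => (hclose k n).trans hk⟩
  refine ⟨ν, hνnull, fun n => ?_, _, isCompact_iInter_of_finite_nets
    (fun i => (s i).2.2.1) hcov, Set.mem_iInter.2 fun i => (s i).2.2.2.1, fun n =>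
    SupportedOn.iInter (fun i => (s i).2.2.1) hanti hcov (hνnull.1 n) fun i =>
      SupportedOn.of_limit fun r hr => ?_⟩
  · have h1 := hclose 0 n
    rw [pow_zero, div_one, norm_sub_rev] at h1
    have h2 : ‖μ n - μ' n‖ ≤ ε / 2 := hd' n
    change ‖μ' n - ν n‖ ≤ ε / 2 at h1
    linarith [norm_sub_le_norm_sub_add_norm_sub (μ n) (μ' n) (ν n)]
  · obtain ⟨k, hik, hk⟩ := hlarge r hr i
    exact ⟨_, ((s k).2.2.2.2.2 n).mono (hanti hik), (hclose k n).trans hk⟩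

/-! ### Passing to the free space over a subset -/

/-- Restriction of Lipschitz functions to a subset, normalised at a new basepoint. -/
theorem exists_restrict (x₀ : X) {A : Set X} (a : A) :
    ∃ T : LipZero X x₀ →L[ℝ] LipZero A a, ∀ f p, T f p = f p - f a := by
  choose g hg hn using fun f : LipZero X x₀ => exists_of_abs_sub_le (X := A) (x₀ := a)
    (g := fun p => f p - f a) (sub_self _) (norm_nonneg f) fun p q => by
      rw [sub_sub_sub_cancel_right]
      exact LipZero.abs_sub_le f p q
  let L : LipZero X x₀ →ₗ[ℝ] LipZero A a :=
    { toFun := g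
      map_add' := fun f f' => LipZero.ext fun p => by
        simp only [hg, LipZero.add_apply]
        ring
      map_smul' := fun c f => LipZero.ext fun p => by
        simp only [hg, LipZero.smul_apply, RingHom.id_apply]
        ring }
  exact ⟨L.mkContinuous 1 fun f => by rw [one_mul]; exact hn f, hg⟩

/-- The McShane extension. -/
theorem exists_extension (x₀ : X) {A : Set X} (a : A) (g : LipZero A a) :
    ∃ f : LipZero X x₀, ‖f‖ ≤ ‖g‖ ∧ ∀ p : A, g p = f p - f a := by
  classical
  have hlip : LipschitzOnWith ⟨‖g‖, norm_nonneg g⟩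
      (fun x => if h : x ∈ A then g ⟨x, h⟩ else 0) A := by
    refine LipschitzOnWith.of_dist_le_mul fun p hp q hq => ?_
    simp only [hp, hq, dif_pos]
    exact LipZero.abs_sub_le g ⟨p, hp⟩ ⟨q, hq⟩
  obtain ⟨h, hh, heq⟩ := hlip.extend_real
  have hA : ∀ p : A, h p = g p := fun p => by
    rw [← heq p.2]
    simp
  obtain ⟨f, hf, hfn⟩ := exists_of_abs_sub_le (x₀ := x₀) (g := fun p => h p - h x₀) (sub_self _)
    (norm_nonneg g) fun p q => by
      rw [sub_sub_sub_cancel_right]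
      exact hh.dist_le_mul p q
  refine ⟨f, hfn, fun p => ?_⟩
  rw [hf, hf, hA, hA, apply_basepoint]
  ring

/-- Weakly null sequences supported on a set whose free space has the Schur property. -/
theorem WeaklyNull.tendsto_of_supportedOn {A : Set X} (hx₀ : x₀ ∈ A) {a : A}
    (hA : SchurProperty (LipFree A a)) {μ : ℕ → StrongDual ℝ (LipZero X x₀)} (hμ : WeaklyNull μ)
    (hsupp : ∀ n, SupportedOn A (μ n)) : Tendsto μ atTop (𝓝 0) := by
  obtain ⟨T, hT⟩ := exists_restrict x₀ a
  let J : StrongDual ℝ (LipZero A a) →L[ℝ] StrongDual ℝ (LipZero X x₀) :=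
    ContinuousLinearMap.precomp ℝ T
  have hJ : ∀ v f, J v f = v (T f) := fun _ _ => rfl
  have hext : ∀ g : LipZero A a, ∃ f : LipZero X x₀, ‖f‖ ≤ ‖g‖ ∧ T f = g := by
    intro g
    obtain ⟨f, hfn, hf⟩ := exists_extension x₀ a g
    exact ⟨f, hfn, LipZero.ext fun p => by rw [hT, hf]⟩
  -- McShane extension lifts every function on `A` without increasing its norm, so the adjoint `J`
  -- of restriction is bounded below, and the image of the free space over `A` is closed.
  have hbelow : ∀ v, ‖v‖ ≤ ‖J v‖ := by
    intro v
    refine v.opNorm_le_bound (norm_nonneg _) fun g => ?_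
    obtain ⟨f, hfn, rfl⟩ := hext g
    rw [← hJ]
    exact ((J v).le_opNorm f).trans (mul_le_mul_of_nonneg_left hfn (norm_nonneg _))
  have hanti : AntilipschitzWith 1 J := AddMonoidHomClass.antilipschitz_of_bound J fun v => by
    simpa using hbelow v
  let P : Submodule ℝ (StrongDual ℝ (LipZero X x₀)) := (LipFree A a).map J.toLinearMap
  have hP : IsClosed (P : Set (StrongDual ℝ (LipZero X x₀))) :=
    (hanti.isClosedEmbedding J.uniformContinuous).isClosedMap _ isClosed
  have hdelta : ∀ p ∈ A, delta x₀ p ∈ P := by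
    intro p hp
    refine ⟨delta a ⟨p, hp⟩ - delta a ⟨x₀, hx₀⟩, sub_mem (delta_mem _) (delta_mem _), ?_⟩
    ext f
    change T f ⟨p, hp⟩ - T f ⟨x₀, hx₀⟩ = f p
    rw [hT, hT, apply_basepoint]
    ring
  have hmem : ∀ n, μ n ∈ P := by
    intro n
    by_contra hn
    -- A functional bounded below on the subspace `P` vanishes there. Its representing Lipschitz
    -- function is therefore zero on `A`, so the support condition gives `φ (μ n) = 0`, against the
    -- separation.
    obtain ⟨φ, u, hu, hb⟩ := geometric_hahn_banach_point_closed P.convex hP hn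
    have hφ : ∀ v ∈ P, φ v = 0 := by
      intro v hv
      by_contra h0
      have := hb (((u - 1) / φ v) • v) (P.smul_mem _ hv)
      rw [map_smul, smul_eq_mul, div_mul_cancel₀ _ h0] at this
      linarith
    have hu0 := hb 0 P.zero_mem
    obtain ⟨f, hf, hfμ⟩ := exists_apply_eq φ
    have h0 : φ (μ n) = 0 := by
      rw [hfμ _ (hμ.1 n)]
      exact hsupp n f fun x hx => by rw [hf, hφ _ (hdelta x hx)]
    rw [map_zero] at hu0
    linarith
  choose v hv hvμ using hmem
  have hv0 : Tendsto v atTop (𝓝 0) := by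
    refine schurProperty_iff.1 hA v hv fun g => ?_
    obtain ⟨f, -, rfl⟩ := hext g
    refine (hμ.2 f).congr fun n => ?_
    rw [← hvμ n]
    exact hJ _ _
  have := (J.continuous.tendsto 0).comp hv0
  rw [map_zero] at this
  exact this.congr hvμ

end LipFree

/-- Finitely many balls from the ideal cover `K`; their union is in the ideal, hence so is its
closed subset `K`. -/
theorem LocallyModeledOn.mem_of_isCompact {X : Type*} [MetricSpace X]
    {I : Order.Ideal (TopologicalSpace.Closeds X)}
    (hX : LocallyModeledOn (I : Set (TopologicalSpace.Closeds X)) ⊤)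
    (K : TopologicalSpace.Closeds X) (hK : IsCompact (K : Set X)) : K ∈ I := by
  suffices H : ∃ A ∈ I, (K : Set X) ⊆ (A : Set X) by
    obtain ⟨A, hA, hKA⟩ := H
    exact I.lower (show K ≤ A from hKA) hA
  refine hK.induction_on (p := fun s => ∃ A ∈ I, s ⊆ (A : Set X)) ?_ ?_ ?_ ?_
  · exact ⟨⊥, I.bot_mem, Set.empty_subset _⟩
  · rintro s t hst ⟨A, hA, h⟩
    exact ⟨A, hA, hst.trans h⟩
  · rintro s t ⟨A, hA, hs⟩ ⟨B, hB, ht⟩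
    refine ⟨A ⊔ B, Order.Ideal.sup_mem hA hB, ?_⟩
    rw [TopologicalSpace.Closeds.coe_sup]
    exact Set.union_subset_union hs ht
  · intro x _
    obtain ⟨θ, hθ, hmem⟩ := hX x trivial
    rw [top_inf_eq] at hmem
    exact ⟨_, mem_nhdsWithin_of_mem_nhds (Metric.closedBall_mem_nhds x hθ), _, hmem, subset_rfl⟩

end

/-- An `Order.Ideal` of the lattice of closed sets is exactly a collection of closed sets that
contains the empty set, is closed under passing to closed subsets and under finite unions. The free
space is formed over each nonempty `A` in `I` with the metric of `X`; up to linear isometry it does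
not depend on the basepoint. -/
theorem mainTheorem2 {X : Type*} [MetricSpace X] [CompleteSpace X]
    (I : Order.Ideal (TopologicalSpace.Closeds X))
    (hX : LocallyModeledOn (I : Set (TopologicalSpace.Closeds X)) ⊤)
    (hI : ∀ A ∈ I, (A : Set X).Nonempty → ∃ a : A, SchurProperty (LipFree A a)) :
    ∀ x₀ : X, SchurProperty (LipFree X x₀) := by
  intro x₀
  refine LipFree.schurProperty_iff.2 fun μ hμ hnull => ?_
  rw [Metric.tendsto_atTop]
  intro ε hε
  obtain ⟨ν, hν, hd, K, hK, hx₀, hsupp⟩ :=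
    LipFree.WeaklyNull.exists_compact ⟨hμ, hnull⟩ (show 0 < ε / 2 by positivity)
  obtain ⟨a, ha⟩ := hI ⟨K, hK.isClosed⟩ (hX.mem_of_isCompact _ hK) ⟨x₀, hx₀⟩
  have hlim : Tendsto ν atTop (𝓝 0) :=
    LipFree.WeaklyNull.tendsto_of_supportedOn (A := K) hx₀ (a := a) ha hν hsupp
  obtain ⟨N, hN⟩ := Metric.tendsto_atTop.1 hlim (ε / 2) (by positivity)
  refine ⟨N, fun n hn => ?_⟩
  have h1 := hN n hn
  rw [dist_zero_right] at h1 ⊢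
  linarith [norm_le_norm_add_norm_sub' (μ n) (ν n), hd n]
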